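/- Let $\Omega\subset\mathbb{C}$ be a region, i.e. a nonempty connected open set together with some, none or all of its boundary points (so that the interior of $\Omega$ is connected and $\Omega$ lies in the closure of its interior). A matrix-valued function is called holomorphic (meromorphic) on $\Omega$ if it is holomorphic (meromorphic) on some open set containing $\Omega$. Let $M$ be an $m\times n$ meromorphic matrix on $\Omega$. A right matrix-fraction description (MFD) of $M$ is a factorization $M(z)=N(z)D(z)^{-1}$ (an identity of meromorphic matrices on $\Omega$), where $N$ is an $m\times n$ and $D$ an $n\times n$ holomorphic matrix on $\Omega$ and $D$ is regular, i.e. $\max_{z\in\Omega}\operatorname{rank}D(z)=n$. It is right coprime if $$\operatorname{rank}\begin{bmatrix}N(z)\\ D(z)\end{bmatrix}=n\qquad\text{for all } z\in\Omega .$$ **Theorem.** If $M(z)=N_1(z)D_1(z)^{-1}=N_2(z)D_2(z)^{-1}$ are right coprime MFDs of $M$ on $\Omega$, then there exists an $n\times n$ holomorphic matrix $U$ on $\Omega$ which is invertible (there is a holomorphic matrix $V$ on $\Omega$ with $U(z)V(z)=V(z)U(z)=I_n$ for all $z\in\Omega$) such that $$N_1(z)=N_2(z)U(z)\quad\text{and}\quad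 D_1(z)=D_2(z)U(z)\qquad\text{for all } z\in\Omega .$$ If moreover $\Omega=\mathbb{C}$ and $D_1$ and $D_2$ are matrix polynomials, then $U$ is a unimodular matrix polynomial, i.e. a matrix polynomial whose determinant is a nonzero constant. -/

import Mathlib

open scoped Polynomial

namespace MFD

/-- A region: a nonempty connected open set (its interior) together with some, none or all of
the boundary points of that open set. -/
structure IsRegion (Ω : Set ℂ) : Prop where
  isConnected_interior : IsConnected (interior Ω)
  subset_closure : Ω ⊆ closure (interior Ω)

/-- A holomorphic matrix on `Ω`: complex differentiable on some open set containing `Ω`.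
Only the values on `Ω` are ever compared. -/
def HolomorphicMatrix (Ω : Set ℂ) {m n : ℕ} (A : ℂ → Matrix (Fin m) (Fin n) ℂ) : Prop :=
  ∃ O : Set ℂ, IsOpen O ∧ Ω ⊆ O ∧ ∀ i j, DifferentiableOn ℂ (fun z => A z i j) O

/-- A meromorphic matrix on `Ω`: meromorphic on some open set containing `Ω`. As for
Mathlib's meromorphic functions, the values at individual points carry no information. -/
def MeromorphicMatrix (Ω : Set ℂ) {m n : ℕ} (M : ℂ → Matrix (Fin m) (Fin n) ℂ) : Prop :=
  ∃ O : Set ℂ, IsOpen O ∧ Ω ⊆ O ∧ ∀ i j, MeromorphicOn (fun z => M z i j) O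

/-- The normal rank of a holomorphic matrix: the maximum of its pointwise ranks
(a nonempty set of naturals bounded by `n` as soon as `Ω` is nonempty). -/
noncomputable def normalRank (Ω : Set ℂ) {m n : ℕ} (A : ℂ → Matrix (Fin m) (Fin n) ℂ) : ℕ :=
  sSup ((fun z => (A z).rank) '' Ω)

/-- A square holomorphic matrix is regular if its normal rank is full. -/
def IsRegular (Ω : Set ℂ) {n : ℕ} (D : ℂ → Matrix (Fin n) (Fin n) ℂ) : Prop :=
  normalRank Ω D = n

/-- The invertible elements of the ring of `n × n` holomorphic matrices on `Ω`. -/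
def InvertibleHolomorphic (Ω : Set ℂ) {n : ℕ} (U : ℂ → Matrix (Fin n) (Fin n) ℂ) : Prop :=
  HolomorphicMatrix Ω U ∧
    ∃ V : ℂ → Matrix (Fin n) (Fin n) ℂ, HolomorphicMatrix Ω V ∧
      ∀ z ∈ Ω, U z * V z = 1 ∧ V z * U z = 1

/-- `M = N D⁻¹` is a right matrix-fraction description on `Ω`. The equation is one of meromorphic
matrices: it holds on `Ω` outside a set of isolated points without accumulation point in `Ω`. -/
structure IsRightMFD (Ω : Set ℂ) {m n : ℕ} (M N : ℂ → Matrix (Fin m) (Fin n) ℂ)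
    (D : ℂ → Matrix (Fin n) (Fin n) ℂ) : Prop where
  holomorphic_num : HolomorphicMatrix Ω N
  holomorphic_den : HolomorphicMatrix Ω D
  regular_den : IsRegular Ω D
  eq : ∀ᶠ z in Filter.codiscreteWithin Ω, M z = N z * (D z)⁻¹

/-- A right matrix-fraction description is right coprime if the stacked matrix of `N` and `D`
has rank `n` at every point of `Ω`. -/
structure IsRightCoprimeMFD (Ω : Set ℂ) {m n : ℕ} (M N : ℂ → Matrix (Fin m) (Fin n) ℂ)
    (D : ℂ → Matrix (Fin n) (Fin n) ℂ) : Prop extends IsRightMFD Ω M N D where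
  rank_eq : ∀ z ∈ Ω, (Matrix.fromRows (N z) (D z)).rank = n

/-- `A` agrees on `Ω` with the matrix polynomial `P`. -/
def EqPolynomialOn (Ω : Set ℂ) {n : ℕ} (A : ℂ → Matrix (Fin n) (Fin n) ℂ)
    (P : Matrix (Fin n) (Fin n) ℂ[X]) : Prop :=
  ∀ z ∈ Ω, A z = P.map (Polynomial.eval z)

/-- A matrix polynomial is unimodular if its determinant is a nonzero constant. -/
def IsUnimodular {n : ℕ} (P : Matrix (Fin n) (Fin n) ℂ[X]) : Prop :=
  ∃ c : ℂ, c ≠ 0 ∧ P.det = Polynomial.C c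

end MFD

namespace MFD

open Filter Topology

section Entrywise

variable {ι κ l : Type*} [Fintype κ]

/-! Stack each description as `A = [N; D]`. Near interior points, off isolated points, `A₁ = A₂ *
(D₂⁻¹ * D₁)`; the task is to extend this factor across all of `Ω`. If `L` is a left inverse of `A₂
a`, then `L * A₂ z` stays invertible near `a`, so `(L * A₂)⁻¹ * (L * A₁)` is holomorphic there, and
the identity theorem makes it a right factor (`exists_local_right_factor`). Full column rank makes
factors unique, so they glue (`exists_right_factor`). Swapping the descriptions gives `V`, and
cancelling gives `U * V = V * U = 1`. In the polynomial case, `det P₂ • U = adj P₂ * P₁` exhibits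
the entries of `U` as continuous quotients of polynomials, hence polynomials; `det U` has no zero,
so it is constant. -/

theorem differentiableOn_mul_apply {A : ℂ → Matrix ι κ ℂ} {B : ℂ → Matrix κ l ℂ} {s : Set ℂ}
    (hA : ∀ i j, DifferentiableOn ℂ (fun z => A z i j) s)
    (hB : ∀ i j, DifferentiableOn ℂ (fun z => B z i j) s) (i : ι) (j : l) :
    DifferentiableOn ℂ (fun z => (A z * B z) i j) s := by
  simp only [Matrix.mul_apply]
  exact DifferentiableOn.fun_sum fun k _ => (hA i k).mul (hB k j)

theorem differentiableOn_det [DecidableEq κ] {A : ℂ → Matrix κ κ ℂ} {s : Set ℂ}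
    (hA : ∀ i j, DifferentiableOn ℂ (fun z => A z i j) s) :
    DifferentiableOn ℂ (fun z => (A z).det) s := by
  simp only [Matrix.det_apply']
  exact DifferentiableOn.fun_sum fun σ _ =>
    (DifferentiableOn.fun_finsetProd fun i _ => hA (σ i) i).const_mul _

theorem differentiableOn_inv_apply [DecidableEq κ] {A : ℂ → Matrix κ κ ℂ} {s : Set ℂ}
    (hA : ∀ i j, DifferentiableOn ℂ (fun z => A z i j) s) (hdet : ∀ z ∈ s, (A z).det ≠ 0)
    (i j : κ) : DifferentiableOn ℂ (fun z => (A z)⁻¹ i j) s := by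
  simp only [Matrix.inv_def, Matrix.smul_apply, Ring.inverse_eq_inv', smul_eq_mul]
  refine ((differentiableOn_det hA).inv hdet).mul ?_
  simp only [Matrix.adjugate_apply]
  refine differentiableOn_det fun a b => ?_
  by_cases h : a = j
  · subst h
    simp
  · simpa [Matrix.updateRow_ne h] using hA a b

end Entrywise

/-- A matrix of full column rank has a left inverse. -/
theorem exists_left_inverse_of_rank_eq {κ : Type*} [Fintype κ] {n : ℕ}
    {A : Matrix κ (Fin n) ℂ} (h : A.rank = n) : ∃ L : Matrix (Fin n) κ ℂ, L * A = 1 := by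
  classical
  have hinj : Function.Injective A.mulVec := by
    rw [Matrix.mulVec_injective_iff]
    rw [linearIndependent_iff_card_eq_finrank_span, Set.finrank, ← Matrix.rank_eq_finrank_span_cols,
      h, Fintype.card_fin]
  obtain ⟨g, hg⟩ := A.mulVecLin.exists_leftInverse_of_injective (LinearMap.ker_eq_bot.2 hinj)
  refine ⟨LinearMap.toMatrix' g, ?_⟩
  have := congrArg LinearMap.toMatrix' hg
  rwa [LinearMap.toMatrix'_comp, LinearMap.toMatrix'_id, ← Matrix.toLin'_apply',
    LinearMap.toMatrix'_toLin'] at this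

/-- A function holomorphic near `Ω` and nonzero at some point of `Ω` is nonzero in a punctured
neighbourhood of every interior point. -/
theorem IsRegion.eventually_ne_zero {Ω O : Set ℂ} (hΩ : IsRegion Ω) (hO : IsOpen O) (hΩO : Ω ⊆ O)
    {f : ℂ → ℂ} (hf : DifferentiableOn ℂ f O) {a : ℂ} (ha : a ∈ Ω) (hfa : f a ≠ 0)
    {x : ℂ} (hx : x ∈ interior Ω) : ∀ᶠ z in 𝓝[≠] x, f z ≠ 0 := by
  have hfO := hf.analyticOnNhd hO
  by_contra hcon
  have hfreq : ∃ᶠ z in 𝓝[≠] x, f z = (fun _ => (0 : ℂ)) z :=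
    (not_eventually.1 hcon).mono fun _ => not_not.1
  have hint : Set.EqOn f (fun _ => 0) (interior Ω) :=
    (hfO.mono (interior_subset.trans hΩO)).eqOn_of_preconnected_of_frequently_eq
      (fun _ _ => analyticAt_const) hΩ.isConnected_interior.isPreconnected hx hfreq
  -- The point `a` may lie on the boundary; a ball around it inside `O` meets the interior and
  -- carries the vanishing to `a`.
  obtain ⟨r, hr, hball⟩ := Metric.isOpen_iff.1 hO a (hΩO ha)
  obtain ⟨y, hyb, hyi⟩ := mem_closure_iff.1 (hΩ.subset_closure ha) _ Metric.isOpen_ball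
    (Metric.mem_ball_self hr)
  have hball0 : Set.EqOn f (fun _ => 0) (Metric.ball a r) :=
    (hfO.mono hball).eqOn_of_preconnected_of_eventuallyEq (fun _ _ => analyticAt_const)
      (convex_ball a r).isPreconnected hyb (hint.eventuallyEq_of_mem
        (isOpen_interior.mem_nhds hyi))
  exact hfa (hball0 (Metric.mem_ball_self hr))

/-- A right divisor of full column rank exists locally if it does so near a single point. -/
theorem exists_local_right_factor {κ : Type*} [Fintype κ] {n : ℕ} {O : Set ℂ} (hO : IsOpen O)
    {A B : ℂ → Matrix κ (Fin n) ℂ}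
    (hA : ∀ i j, DifferentiableOn ℂ (fun z => A z i j) O)
    (hB : ∀ i j, DifferentiableOn ℂ (fun z => B z i j) O) {a : ℂ} (ha : a ∈ O)
    (hrank : (A a).rank = n)
    (hex : ∀ W ∈ 𝓝 a, ∃ x ∈ W, ∀ᶠ z in 𝓝[≠] x,
      ∃ C : Matrix (Fin n) (Fin n) ℂ, B z = A z * C) :
    ∃ W, IsOpen W ∧ a ∈ W ∧ ∃ U : ℂ → Matrix (Fin n) (Fin n) ℂ,
      (∀ i j, DifferentiableOn ℂ (fun z => U z i j) W) ∧
      ∀ z ∈ W, B z = A z * U z ∧ ∀ X Y : Matrix (Fin n) (Fin n) ℂ, A z * X = A z * Y → X = Y := by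
  obtain ⟨L, hL⟩ := exists_left_inverse_of_rank_eq hrank
  have hL' : ∀ i j, DifferentiableOn ℂ (fun _ : ℂ => L i j) O := fun i j => differentiableOn_const _
  have hG := differentiableOn_mul_apply hL' hA
  have hH := differentiableOn_mul_apply hL' hB
  have hdet := differentiableOn_det hG
  have hmem : O ∩ {z | (L * A z).det ≠ 0} ∈ 𝓝 a :=
    inter_mem (hO.mem_nhds ha) ((hdet.continuousOn.continuousAt (hO.mem_nhds ha)).eventually_ne
      (by simp [hL]))
  obtain ⟨r, hr, hball⟩ := Metric.mem_nhds_iff.1 hmem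
  have hbO : Metric.ball a r ⊆ O := fun z hz => (hball hz).1
  have hU := differentiableOn_mul_apply
    (differentiableOn_inv_apply (fun i j => (hG i j).mono hbO) fun z hz => (hball hz).2)
    (fun i j => (hH i j).mono hbO)
  have hcancel : ∀ z ∈ Metric.ball a r, (L * A z)⁻¹ * (L * A z) = 1 := fun z hz =>
    Matrix.nonsing_inv_mul _ (isUnit_iff_ne_zero.2 (hball hz).2)
  refine ⟨Metric.ball a r, Metric.isOpen_ball, Metric.mem_ball_self hr,
    fun z => (L * A z)⁻¹ * (L * B z), hU, fun z hz => ⟨?_, fun X Y h => ?_⟩⟩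
  · ext i j
    obtain ⟨x, hx, hev⟩ := hex _ (Metric.ball_mem_nhds a hr)
    have hAU := differentiableOn_mul_apply (fun i j => (hA i j).mono hbO) hU i j
    refine (((hB i j).mono hbO).analyticOnNhd
      Metric.isOpen_ball).eqOn_of_preconnected_of_frequently_eq
      (hAU.analyticOnNhd Metric.isOpen_ball) (convex_ball a r).isPreconnected hx
      (Eventually.frequently ?_) hz
    filter_upwards [hev, mem_nhdsWithin_of_mem_nhds (Metric.isOpen_ball.mem_nhds hx)]
      with w ⟨C, hC⟩ hw
    rw [hC, ← Matrix.mul_assoc L, ← Matrix.mul_assoc _ (L * A w), hcancel w hw, Matrix.one_mul]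
  · calc X = (L * A z)⁻¹ * (L * (A z * X)) := by
          rw [← Matrix.mul_assoc L, ← Matrix.mul_assoc, hcancel z hz, Matrix.one_mul]
      _ = (L * A z)⁻¹ * (L * (A z * Y)) := by rw [h]
      _ = Y := by rw [← Matrix.mul_assoc L, ← Matrix.mul_assoc, hcancel z hz, Matrix.one_mul]

/-- Local right factors through matrices of full column rank glue to a holomorphic one. -/
theorem exists_right_factor {κ : Type*} [Fintype κ] {n : ℕ} {Ω O : Set ℂ} (hO : IsOpen O)
    (hΩO : Ω ⊆ O) {A B : ℂ → Matrix κ (Fin n) ℂ}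
    (hA : ∀ i j, DifferentiableOn ℂ (fun z => A z i j) O)
    (hB : ∀ i j, DifferentiableOn ℂ (fun z => B z i j) O)
    (hrank : ∀ a ∈ Ω, (A a).rank = n)
    (hex : ∀ a ∈ Ω, ∀ W ∈ 𝓝 a, ∃ x ∈ W, ∀ᶠ z in 𝓝[≠] x,
      ∃ C : Matrix (Fin n) (Fin n) ℂ, B z = A z * C) :
    ∃ U : ℂ → Matrix (Fin n) (Fin n) ℂ, HolomorphicMatrix Ω U ∧ ∀ z ∈ Ω, B z = A z * U z := by
  choose! W hWo haW U hU hBU using fun a ha =>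
    exists_local_right_factor hO hA hB (hΩO ha) (hrank a ha) (hex a ha)
  -- Cancellation holds pointwise on each `W a`, even off `Ω`, so overlaps need no connectedness
  -- argument.
  have hloc : ∀ z, ∃ C, ∀ a ∈ Ω, z ∈ W a → C = U a z := by
    intro z
    by_cases h : ∃ a ∈ Ω, z ∈ W a
    · obtain ⟨a, ha, hz⟩ := h
      refine ⟨U a z, fun b hb hzb => (hBU a ha z hz).2 _ _ ?_⟩
      rw [← (hBU a ha z hz).1, ← (hBU b hb z hzb).1]
    · exact ⟨0, fun a ha hz => (h ⟨a, ha, hz⟩).elim⟩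
  choose V hV using hloc
  refine ⟨V, ⟨⋃ a ∈ Ω, W a, isOpen_biUnion hWo, fun a ha => Set.mem_biUnion ha (haW a ha), ?_⟩,
    fun z hz => by rw [hV z z hz (haW z hz)]; exact (hBU z hz z (haW z hz)).1⟩
  intro i j z hz
  obtain ⟨a, ha, hza⟩ := Set.mem_iUnion₂.1 hz
  refine (((hU a ha i j).differentiableAt ((hWo a ha).mem_nhds hza)).congr_of_eventuallyEq
    ?_).differentiableWithinAt
  filter_upwards [(hWo a ha).mem_nhds hza] with w hw
  rw [hV w a ha hw]

theorem IsRegular.exists_det_ne_zero {Ω : Set ℂ} (hΩ : Ω.Nonempty) {n : ℕ}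
    {D : ℂ → Matrix (Fin n) (Fin n) ℂ} (h : IsRegular Ω D) : ∃ a ∈ Ω, (D a).det ≠ 0 := by
  have hmem := Nat.sSup_mem (hΩ.image fun z => (D z).rank)
    ⟨n, by rintro _ ⟨z, -, rfl⟩; simpa using (D z).rank_le_width⟩
  obtain ⟨a, ha, hr⟩ := hmem
  refine ⟨a, ha, ?_⟩
  obtain ⟨L, hL⟩ := exists_left_inverse_of_rank_eq (hr.trans h)
  intro h0
  simpa [h0] using congrArg Matrix.det hL

theorem IsRightMFD.eventually_isUnit_det {Ω : Set ℂ} (hΩ : IsRegion Ω) {m n : ℕ}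
    {M N : ℂ → Matrix (Fin m) (Fin n) ℂ} {D : ℂ → Matrix (Fin n) (Fin n) ℂ}
    (h : IsRightMFD Ω M N D) {x : ℂ} (hx : x ∈ interior Ω) :
    ∀ᶠ z in 𝓝[≠] x, M z = N z * (D z)⁻¹ ∧ IsUnit (D z).det := by
  obtain ⟨O, hO, hΩO, hD⟩ := h.holomorphic_den
  obtain ⟨a, ha, hda⟩ := h.regular_den.exists_det_ne_zero ⟨x, interior_subset hx⟩
  have heq : ∀ᶠ z in 𝓝[≠] x, z ∉ Ω \ {z | M z = N z * (D z)⁻¹} := by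
    have := mem_codiscreteWithin.1 h.eq x (interior_subset hx)
    rwa [Filter.disjoint_principal_right] at this
  filter_upwards [heq, hΩ.eventually_ne_zero hO hΩO (differentiableOn_det hD) ha hda hx,
    mem_nhdsWithin_of_mem_nhds (mem_interior_iff_mem_nhds.1 hx)] with z h1 h2 h3
  exact ⟨by_contra fun h4 => h1 ⟨h3, h4⟩, isUnit_iff_ne_zero.2 h2⟩

theorem HolomorphicMatrix.exists_fromRows {Ω : Set ℂ} {m n : ℕ}
    {N : ℂ → Matrix (Fin m) (Fin n) ℂ} {D : ℂ → Matrix (Fin n) (Fin n) ℂ}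
    (hN : HolomorphicMatrix Ω N) (hD : HolomorphicMatrix Ω D) :
    ∃ O : Set ℂ, IsOpen O ∧ Ω ⊆ O ∧
      ∀ i j, DifferentiableOn ℂ (fun z => Matrix.fromRows (N z) (D z) i j) O := by
  obtain ⟨O, hO, hΩO, hN⟩ := hN
  obtain ⟨O', hO', hΩO', hD⟩ := hD
  refine ⟨O ∩ O', hO.inter hO', Set.subset_inter hΩO hΩO', ?_⟩
  rintro (i | i) j
  · exact (hN i j).mono Set.inter_subset_left
  · exact (hD i j).mono Set.inter_subset_right

/-- Only the divisor needs to be coprime, so the lemma applies in both directions. -/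
theorem IsRightCoprimeMFD.exists_right_factor {Ω : Set ℂ} (hΩ : IsRegion Ω) {m n : ℕ}
    {M N₁ N₂ : ℂ → Matrix (Fin m) (Fin n) ℂ} {D₁ D₂ : ℂ → Matrix (Fin n) (Fin n) ℂ}
    (h₁ : IsRightMFD Ω M N₁ D₁) (h₂ : IsRightCoprimeMFD Ω M N₂ D₂) :
    ∃ U : ℂ → Matrix (Fin n) (Fin n) ℂ, HolomorphicMatrix Ω U ∧
      ∀ z ∈ Ω, Matrix.fromRows (N₁ z) (D₁ z) = Matrix.fromRows (N₂ z) (D₂ z) * U z := by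
  obtain ⟨O, hO, hΩO, hB⟩ := h₁.holomorphic_num.exists_fromRows h₁.holomorphic_den
  obtain ⟨O', hO', hΩO', hA⟩ := h₂.holomorphic_num.exists_fromRows h₂.holomorphic_den
  refine MFD.exists_right_factor (hO.inter hO') (Set.subset_inter hΩO hΩO')
    (fun i j => (hA i j).mono Set.inter_subset_right)
    (fun i j => (hB i j).mono Set.inter_subset_left) h₂.rank_eq fun a ha W hW => ?_
  obtain ⟨x, hxW, hx⟩ := mem_closure_iff_nhds.1 (hΩ.subset_closure ha) W hW
  refine ⟨x, hxW, ?_⟩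
  filter_upwards [h₁.eventually_isUnit_det hΩ hx, h₂.toIsRightMFD.eventually_isUnit_det hΩ hx]
    with z ⟨h1, hu1⟩ ⟨h2, hu2⟩
  refine ⟨(D₂ z)⁻¹ * D₁ z, ?_⟩
  rw [Matrix.fromRows_mul, ← Matrix.mul_assoc, ← Matrix.mul_assoc, ← h2, h1, Matrix.mul_assoc,
    Matrix.nonsing_inv_mul _ hu1, Matrix.mul_nonsing_inv _ hu2, Matrix.mul_one, Matrix.one_mul]

/-- A continuous quotient of complex polynomials is a polynomial. -/
theorem exists_polynomial_of_eval_mul_eq {u : ℂ → ℂ} (hu : Continuous u) (q : ℂ[X]) (hq : q ≠ 0)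
    (p : ℂ[X]) (h : ∀ z, q.eval z * u z = p.eval z) : ∃ r : ℂ[X], ∀ z, u z = r.eval z := by
  induction hd : q.natDegree generalizing q p with
  | zero =>
    obtain ⟨c, rfl⟩ := Polynomial.natDegree_eq_zero.1 hd
    have hc : c ≠ 0 := by rintro rfl; simp at hq
    refine ⟨Polynomial.C c⁻¹ * p, fun z => ?_⟩
    rw [Polynomial.eval_mul, ← h z]
    simp [hc]
  | succ d ih =>
    obtain ⟨a, ha⟩ := IsAlgClosed.exists_root q fun h0 => by
      simp [Polynomial.natDegree_eq_zero_iff_degree_le_zero.2 h0.le] at hd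
    obtain ⟨q', rfl⟩ := Polynomial.dvd_iff_isRoot.2 ha
    have hpa : p.IsRoot a := by
      rw [Polynomial.IsRoot, ← h a]
      simp
    obtain ⟨p', rfl⟩ := Polynomial.dvd_iff_isRoot.2 hpa
    have hq' : q' ≠ 0 := right_ne_zero_of_mul hq
    refine ih q' hq' p' ?_ ?_
    -- The factor `w - a` cancels off `a`; continuity recovers the identity at `a`.
    · refine fun z => congrFun (Continuous.ext_on (dense_compl_singleton a)
        (q'.continuous.mul hu) p'.continuous fun w hw => ?_) z
      have hw' : w - a ≠ 0 := sub_ne_zero.2 hw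
      have := h w
      simp only [Polynomial.eval_mul, Polynomial.eval_sub, Polynomial.eval_X, Polynomial.eval_C,
        mul_assoc] at this
      exact mul_left_cancel₀ hw' this
    · rw [Polynomial.natDegree_mul (Polynomial.X_sub_C_ne_zero a) hq',
        Polynomial.natDegree_X_sub_C] at hd
      omega

theorem det_map_eval {n : ℕ} (P : Matrix (Fin n) (Fin n) ℂ[X]) (z : ℂ) :
    (P.map (Polynomial.eval z)).det = P.det.eval z :=
  ((Polynomial.evalRingHom z).map_det P).symm

/-- An entire right quotient of matrix polynomials is a matrix polynomial. -/
theorem exists_eqPolynomialOn_of_mul_eq {n : ℕ} {U D₁ D₂ : ℂ → Matrix (Fin n) (Fin n) ℂ}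
    (hU : HolomorphicMatrix Set.univ U) {P₁ P₂ : Matrix (Fin n) (Fin n) ℂ[X]}
    (hP₁ : EqPolynomialOn Set.univ D₁ P₁) (hP₂ : EqPolynomialOn Set.univ D₂ P₂)
    (hdet : ∃ z, (D₂ z).det ≠ 0) (h : ∀ z, D₁ z = D₂ z * U z) :
    ∃ P, EqPolynomialOn Set.univ U P := by
  obtain ⟨O, -, hO, hU⟩ := hU
  have hUc : ∀ i j, Continuous fun z => U z i j := fun i j => by
    rw [← continuousOn_univ]
    exact ((hU i j).mono hO).continuousOn
  have hq : P₂.det ≠ 0 := by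
    obtain ⟨z, hz⟩ := hdet
    rw [hP₂ z trivial, det_map_eval] at hz
    rintro h0
    simp [h0] at hz
  have hadj : ∀ z, (P₂.det.eval z) • U z = (P₂.adjugate * P₁).map (Polynomial.eval z) := by
    intro z
    have h1 : (P₂.adjugate * P₁).map (Polynomial.eval z) =
        (P₂.map (Polynomial.eval z)).adjugate * P₁.map (Polynomial.eval z) := by
      rw [← Polynomial.coe_evalRingHom, Matrix.map_mul]
      congr 1
      exact (Polynomial.evalRingHom z).map_adjugate P₂
    rw [h1, ← hP₁ z trivial, h z, ← hP₂ z trivial, ← Matrix.mul_assoc, Matrix.adjugate_mul,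
      ← det_map_eval, ← hP₂ z trivial, Matrix.smul_mul, Matrix.one_mul]
  choose P hP using fun i j => exists_polynomial_of_eval_mul_eq (hUc i j) P₂.det hq
    ((P₂.adjugate * P₁) i j) fun z => by simpa using congrFun₂ (hadj z) i j
  exact ⟨Matrix.of P, fun z _ => by ext i j; simpa using hP i j z⟩

theorem isUnimodular_of_det_ne_zero {n : ℕ} {P : Matrix (Fin n) (Fin n) ℂ[X]}
    (h : ∀ z, (P.map (Polynomial.eval z)).det ≠ 0) : IsUnimodular P := by
  have hdeg : P.det.degree = 0 := by
    by_contra h0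
    obtain ⟨a, ha⟩ := IsAlgClosed.exists_root P.det h0
    exact h a ((det_map_eval P a).trans ha)
  refine ⟨P.det.coeff 0, fun h0 => h 0 ?_, Polynomial.eq_C_of_degree_eq_zero hdeg⟩
  rw [det_map_eval, ← Polynomial.coeff_zero_eq_eval_zero, h0]

/-- Substitution gives `[N; D] = [N; D] * (U * V)`, and a left inverse cancels `[N; D]`. -/
theorem mul_eq_one_of_fromRows {m n : ℕ} {N N' : Matrix (Fin m) (Fin n) ℂ}
    {D D' U V : Matrix (Fin n) (Fin n) ℂ} (hrank : (Matrix.fromRows N D).rank = n)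
    (hU : Matrix.fromRows N' D' = Matrix.fromRows N D * U)
    (hV : Matrix.fromRows N D = Matrix.fromRows N' D' * V) : U * V = 1 := by
  obtain ⟨L, hL⟩ := exists_left_inverse_of_rank_eq hrank
  rw [hU, Matrix.mul_assoc] at hV
  calc U * V = L * (Matrix.fromRows N D * (U * V)) := by
        rw [← Matrix.mul_assoc L, hL, Matrix.one_mul]
    _ = 1 := by rw [← hV, hL]

end MFD

theorem mainTheorem6 (Ω : Set ℂ) (hΩ : MFD.IsRegion Ω) (m n : ℕ)
    (M : ℂ → Matrix (Fin m) (Fin n) ℂ) (hM : MFD.MeromorphicMatrix Ω M)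
    (N₁ N₂ : ℂ → Matrix (Fin m) (Fin n) ℂ) (D₁ D₂ : ℂ → Matrix (Fin n) (Fin n) ℂ)
    (h₁ : MFD.IsRightCoprimeMFD Ω M N₁ D₁) (h₂ : MFD.IsRightCoprimeMFD Ω M N₂ D₂) :
    ∃ U : ℂ → Matrix (Fin n) (Fin n) ℂ,
      MFD.InvertibleHolomorphic Ω U ∧
      (∀ z ∈ Ω, N₁ z = N₂ z * U z) ∧
      (∀ z ∈ Ω, D₁ z = D₂ z * U z) ∧
      (Ω = Set.univ →
        (∃ P₁, MFD.EqPolynomialOn Ω D₁ P₁) → (∃ P₂, MFD.EqPolynomialOn Ω D₂ P₂) →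
        ∃ P, MFD.EqPolynomialOn Ω U P ∧ MFD.IsUnimodular P) := by
  obtain ⟨U, hU, hUeq⟩ :=
    MFD.IsRightCoprimeMFD.exists_right_factor hΩ h₁.toIsRightMFD h₂
  obtain ⟨V, hV, hVeq⟩ :=
    MFD.IsRightCoprimeMFD.exists_right_factor hΩ h₂.toIsRightMFD h₁
  have hinv : ∀ z ∈ Ω, U z * V z = 1 ∧ V z * U z = 1 := fun z hz =>
    ⟨MFD.mul_eq_one_of_fromRows (h₂.rank_eq z hz) (hUeq z hz) (hVeq z hz),
      MFD.mul_eq_one_of_fromRows (h₁.rank_eq z hz) (hVeq z hz) (hUeq z hz)⟩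
  have hrows : ∀ z ∈ Ω, N₁ z = N₂ z * U z ∧ D₁ z = D₂ z * U z := fun z hz => by
    have := hUeq z hz
    rwa [Matrix.fromRows_mul, Matrix.fromRows_ext_iff] at this
  refine ⟨U, ⟨hU, V, hV, hinv⟩, fun z hz => (hrows z hz).1, fun z hz => (hrows z hz).2, ?_⟩
  rintro rfl ⟨P₁, hP₁⟩ ⟨P₂, hP₂⟩
  obtain ⟨a, -, ha⟩ := h₂.regular_den.exists_det_ne_zero Set.univ_nonempty
  obtain ⟨P, hP⟩ := MFD.exists_eqPolynomialOn_of_mul_eq hU hP₁ hP₂ ⟨a, ha⟩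
    fun z => (hrows z trivial).2
  refine ⟨P, hP, MFD.isUnimodular_of_det_ne_zero fun z => ?_⟩
  rw [← hP z trivial]
  intro h0
  simpa [h0] using congrArg Matrix.det (hinv z trivial).1
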